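/- Let $\alpha=(1+\sqrt5)/2$, and let $F_n$ and $L_n$ ($n\in\mathbb Z$) be the Fibonacci and Lucas numbers: $F_0=0$, $F_1=1$, $L_0=2$, $L_1=1$, $F_n=F_{n-1}+F_{n-2}$ and $L_n=L_{n-1}+L_{n-2}$ for $n\ge2$, and $F_{-n}=(-1)^{n-1}F_n$, $L_{-n}=(-1)^nL_n$. For integers $j\ge1$ put $H_1(j)=\frac14$ and, for $m\ge1$, $$H_{m+1}(j)=\frac14\sum_{n_1=1}^{j-1}\frac1{(2n_1)^2}\sum_{n_2=1}^{n_1-1}\frac1{(2n_2)^2}\cdots\sum_{n_m=1}^{n_{m-1}-1}\frac1{(2n_m)^2}.$$ Then for every integer $s$ and every integer $m\ge1$ the following two series converge absolutely and $$\sum_{j=1}^\infty\frac{H_m(j)}{j^2\binom{2j}{j}}F_{2j+s}=\frac1{(2m)!}\left(\frac{\pi}{10}\right)^{2m}\frac1{\sqrt5}\left((3^{2m}+1)\alpha^s-L_s\right),$$ $$\sum_{j=1}^\infty\frac{H_m(j)}{j^2\binom{2j}{j}}L_{2j+s}=\frac1{(2m)!}\left(\frac{\pi}{10}\right)^{2m}\left((3^{2m}-1)\alpha^s+L_s\right).$$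 -/

import Mathlib

/-- Lucas numbers with natural index: `L₀ = 2`, `L₁ = 1`, `Lₙ₊₂ = Lₙ₊₁ + Lₙ`. -/
def natLucas : ℕ → ℤ
  | 0 => 2
  | 1 => 1
  | n + 2 => natLucas (n + 1) + natLucas n

/-- Lucas numbers with integer index, extended by `L₋ₙ = (-1)ⁿ Lₙ`.
(The Fibonacci numbers with integer index are `Int.fib`.) -/
def intLucas : ℤ → ℤ
  | Int.ofNat n => natLucas n
  | Int.negSucc n => (-1) ^ (n + 1) * natLucas (n + 1)

/-- The `k`-fold nested sum
`∑_{n₁=1}^{j-1} 1/(2n₁)² ∑_{n₂=1}^{n₁-1} 1/(2n₂)² ⋯ ∑_{n_k=1}^{n_{k-1}-1} 1/(2n_k)²`,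
equal to `1` when `k = 0`. -/
noncomputable def nestedSum : ℕ → ℕ → ℝ
  | 0, _ => 1
  | k + 1, j => ∑ n ∈ Finset.Ico 1 j, 1 / (2 * (n : ℝ)) ^ 2 * nestedSum k n

/-- `H_m(j)` for `m ≥ 1`: `H₁(j) = 1/4`, and `H_{k+1}(j)` is a quarter of the `k`-fold nested sum.
The value at `m = 0` is a convention that is never used. -/
noncomputable def nestedH : ℕ → ℕ → ℝ
  | 0, _ => 0
  | k + 1, j => 1 / 4 * nestedSum k j

/-! With `x = sin θ`, the operator `(1 - x²) d²/dx² - x d/dx` is `d²/dθ²`, which sends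
`θ^(2m)/(2m)!` to its predecessor. On Maclaurin coefficients this is `arcsinCoeff_recurrence`, so
induction on `m` gives `∑ H_m(j) (2 sin θ)^(2j) / (j² (2j choose j)) = θ^(2m)/(2m)!`
(`tsum_arcsinCoeff_sin`, `hasSum_nestedH_mul_pow`). The angles `3π/10` and `-π/10` make `2 sin θ`
equal to the golden ratio and its conjugate. Weighting the two series by `s`-th powers and combining
them by Binet gives both formulas. Real `HasSum` is unconditional, hence absolute. -/

theorem natLucas_eq (n : ℕ) :
    (natLucas n : ℝ) = Real.goldenRatio ^ n + Real.goldenConj ^ n := by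
  induction n using Nat.twoStepInduction with
  | zero => norm_num [natLucas]
  | one => simp [natLucas]
  | more n ih0 ih1 =>
    rw [natLucas, Int.cast_add, ih0, ih1, pow_add _ n 2, pow_add _ n 2,
      Real.goldenRatio_sq, Real.goldenConj_sq]
    ring

/-- Binet's formula for Lucas numbers with integer index. -/
theorem intLucas_eq (s : ℤ) :
    (intLucas s : ℝ) = Real.goldenRatio ^ s + Real.goldenConj ^ s := by
  cases s with
  | ofNat n => simpa [intLucas] using natLucas_eq n
  | negSucc n =>
    rw [intLucas, zpow_negSucc, zpow_negSucc, ← inv_pow, ← inv_pow, Real.inv_goldenRatio,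
      Real.inv_goldenConj]
    push_cast
    rw [natLucas_eq, mul_add, ← mul_pow, ← mul_pow]
    ring

theorem sin_three_pi_div_ten : Real.sin (3 * (Real.pi / 10)) = Real.goldenRatio / 2 := by
  rw [show 3 * (Real.pi / 10) = Real.pi / 2 - Real.pi / 5 by ring, Real.sin_pi_div_two_sub,
    Real.cos_pi_div_five, Real.goldenRatio]
  ring

theorem sin_neg_pi_div_ten : Real.sin (-(Real.pi / 10)) = Real.goldenConj / 2 := by
  rw [show -(Real.pi / 10) = -(Real.pi / 2 - 2 * (Real.pi / 5)) by ring, Real.sin_neg,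
    Real.sin_pi_div_two_sub, Real.cos_two_mul, Real.cos_pi_div_five, Real.goldenConj]
  have h := Real.sq_sqrt (show (0 : ℝ) ≤ 5 by norm_num)
  linarith

/-! ### Power series in the unit disc and their differential equation. -/

theorem summable_mul_pow_of_le_choose {a : ℕ → ℝ} {C : ℝ} {k : ℕ}
    (ha : ∀ n, |a n| ≤ C * ((n + k).choose k : ℝ)) {x : ℝ} (hx : |x| < 1) :
    Summable fun n => a n * x ^ n := by
  have hs := (summable_choose_mul_geometric_of_norm_lt_one k
    (r := |x|) (by simpa using hx)).mul_left C
  refine hs.of_norm_bounded fun n => ?_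
  rw [Real.norm_eq_abs, abs_mul, abs_pow, ← mul_assoc]
  gcongr
  exact ha n

/-- Binomial growth bounds survive formal differentiation, with `k` raised by one, so the same
lemmas apply to a series and its derivatives. -/
theorem abs_succ_mul_le_choose {a : ℕ → ℝ} {C : ℝ} {k : ℕ}
    (ha : ∀ n, |a n| ≤ C * ((n + k).choose k : ℝ)) (n : ℕ) :
    |((n : ℝ) + 1) * a (n + 1)| ≤ C * (k + 1) * ((n + (k + 1)).choose (k + 1) : ℝ) := by
  have h := Nat.choose_succ_right_eq (n + 1 + k) k
  rw [show n + 1 + k - k = n + 1 by omega] at h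
  have h' : ((n + (k + 1)).choose (k + 1) : ℝ) * (k + 1) = ((n + 1 + k).choose k : ℝ) * (n + 1) := by
    rw [show n + (k + 1) = n + 1 + k by ring]
    exact_mod_cast h
  rw [abs_mul, abs_of_nonneg (by positivity : (0 : ℝ) ≤ (n : ℝ) + 1)]
  calc ((n : ℝ) + 1) * |a (n + 1)| ≤ (n + 1) * (C * ((n + 1 + k).choose k : ℝ)) := by
        gcongr
        exact ha (n + 1)
    _ = C * (((n + 1 + k).choose k : ℝ) * (n + 1)) := by ring
    _ = _ := by rw [← h']; ring

/-- Termwise differentiation of a real power series in the unit disc. -/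
theorem hasDerivAt_tsum_mul_pow {a : ℕ → ℝ} {C : ℝ} {k : ℕ}
    (ha : ∀ n, |a n| ≤ C * ((n + k).choose k : ℝ)) {x : ℝ} (hx : |x| < 1) :
    HasDerivAt (fun y => ∑' n, a n * y ^ n) (∑' n : ℕ, ((n : ℝ) + 1) * a (n + 1) * x ^ n) x := by
  obtain ⟨r, hxr, hr⟩ := exists_between hx
  have hr0 : 0 < r := (abs_nonneg x).trans_lt hxr
  have hr1 : |r| < 1 := by rwa [abs_of_pos hr0]
  have hu : Summable fun n : ℕ => |(n : ℝ) * a n| * r ^ (n - 1) := by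
    rw [← summable_nat_add_iff 1]
    refine Summable.congr (summable_mul_pow_of_le_choose
      (a := fun n : ℕ => |((n : ℝ) + 1) * a (n + 1)|) (C := C * (k + 1)) (k := k + 1)
      (fun n => ?_) hr1) fun n => by simp
    rw [abs_abs]
    exact abs_succ_mul_le_choose ha n
  have key := hasDerivAt_tsum_of_isPreconnected (g := fun n y => a n * y ^ n)
    (g' := fun n y => (n : ℝ) * a n * y ^ (n - 1)) (t := Set.Ioo (-r) r) hu isOpen_Ioo
    isPreconnected_Ioo (y₀ := x) (y := x) (fun n y _ => ?_) (fun n y hy => ?_) (abs_lt.1 hxr)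
    (summable_mul_pow_of_le_choose ha hx) (abs_lt.1 hxr)
  · convert! key using 1
    have hs : Summable fun n : ℕ => (n : ℝ) * a n * x ^ (n - 1) := by
      refine hu.of_norm_bounded fun n => ?_
      rw [Real.norm_eq_abs, abs_mul, abs_pow]
      gcongr
    rw [hs.tsum_eq_zero_add]
    simp
  · convert! (hasDerivAt_pow n y).const_mul (a n) using 1
    ring
  · rw [Real.norm_eq_abs, abs_mul, abs_pow]
    gcongr
    exact (abs_lt.2 hy).le

/-- If `(n + 2) (n + 1) aₙ₊₂ - n² aₙ = bₙ`, then `A = ∑ aₙ xⁿ` and `B = ∑ bₙ xⁿ` satisfy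
`(1 - x²) A'' - x A' = B`. -/
theorem tsum_ode_of_recurrence {a b : ℕ → ℝ} {C : ℝ} (ha : ∀ n, |a n| ≤ C)
    (hab : ∀ n : ℕ, ((n : ℝ) + 1) * (((n : ℝ) + 2) * a (n + 2)) - (n : ℝ) ^ 2 * a n = b n)
    {x : ℝ} (hx : |x| < 1) :
    (1 - x ^ 2) * ∑' n : ℕ, ((n : ℝ) + 1) * ((((n + 1 : ℕ) : ℝ) + 1) * a (n + 1 + 1)) * x ^ n
      - x * ∑' n : ℕ, ((n : ℝ) + 1) * a (n + 1) * x ^ n = ∑' n, b n * x ^ n := by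
  have h0 : ∀ n, |a n| ≤ C * ((n + 0).choose 0 : ℝ) := by simpa using ha
  have h1 := abs_succ_mul_le_choose h0
  have h2 := abs_succ_mul_le_choose (a := fun n : ℕ => ((n : ℝ) + 1) * a (n + 1)) h1
  have s1 := (summable_mul_pow_of_le_choose (a := fun n : ℕ => ((n : ℝ) + 1) * a (n + 1))
    h1 hx).hasSum
  have s2 := (summable_mul_pow_of_le_choose
    (a := fun n : ℕ => ((n : ℝ) + 1) * ((((n + 1 : ℕ) : ℝ) + 1) * a (n + 1 + 1))) h2 hx).hasSum
  set S1 := ∑' n : ℕ, ((n : ℝ) + 1) * a (n + 1) * x ^ n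
  set S2 := ∑' n : ℕ, ((n : ℝ) + 1) * ((((n + 1 : ℕ) : ℝ) + 1) * a (n + 1 + 1)) * x ^ n
  -- Split `n² = n(n - 1) + n`; the terms lost in the index shifts vanish because of these factors.
  have t1 : HasSum (fun n : ℕ => (n : ℝ) * a n * x ^ n) (x * S1) := by
    rw [← hasSum_nat_add_iff' 1]
    convert! s1.mul_left x using 1
    · ext n; push_cast; ring
    · simp
  have t2 : HasSum (fun n : ℕ => (n : ℝ) * (n - 1) * a n * x ^ n) (x ^ 2 * S2) := by
    rw [← hasSum_nat_add_iff' 2]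
    convert! s2.mul_left (x ^ 2) using 1
    · ext n; push_cast; ring
    · simp [Finset.sum_range_succ]
  have h := (s2.sub (t2.add t1)).congr_fun (g := fun n => b n * x ^ n) fun n => by
    rw [← hab]; push_cast; ring
  rw [h.tsum_eq]
  ring

/-- A function on an open interval around `0` with `f'' = 0` and `f 0 = f' 0 = 0` vanishes. -/
theorem eq_zero_of_second_deriv_eq_zero {f f' : ℝ → ℝ} {r : ℝ} (hr : 0 < r)
    (hf : ∀ x ∈ Set.Ioo (-r) r, HasDerivAt f (f' x) x)
    (hf' : ∀ x ∈ Set.Ioo (-r) r, HasDerivAt f' 0 x) (h0 : f 0 = 0) (h0' : f' 0 = 0)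
    {x : ℝ} (hx : x ∈ Set.Ioo (-r) r) : f x = 0 := by
  have hz : (0 : ℝ) ∈ Set.Ioo (-r) r := by simp [hr]
  have key : ∀ g : ℝ → ℝ, (∀ y ∈ Set.Ioo (-r) r, HasDerivAt g 0 y) → g 0 = 0 →
      ∀ y ∈ Set.Ioo (-r) r, g y = 0 := fun g hg hg0 y hy => by
    rw [← hg0]
    exact isOpen_Ioo.is_const_of_deriv_eq_zero isPreconnected_Ioo
      (fun z hz => (hg z hz).differentiableAt.differentiableWithinAt)
      (fun z hz => (hg z hz).deriv) hy hz
  exact key f (fun y hy => by simpa [key f' hf' h0' y hy] using hf y hy) h0 x hx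

/-! ### Nested sums and arcsine coefficients. -/

theorem nestedSum_nonneg (k j : ℕ) : 0 ≤ nestedSum k j := by
  induction k generalizing j with
  | zero => simp [nestedSum]
  | succ k ih => exact Finset.sum_nonneg fun n _ => mul_nonneg (by positivity) (ih n)

/-- A crude bound, but linear growth is exactly offset by `arcsinWeight_mul_le`, so the coefficients
stay bounded. -/
theorem nestedSum_le (k j : ℕ) : nestedSum k (j + 1) ≤ j + 1 := by
  induction k generalizing j with
  | zero => simp [nestedSum]
  | succ k ih =>
    rw [nestedSum, Finset.sum_Ico_eq_sum_range, Nat.add_sub_cancel]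
    calc _ ≤ ∑ n ∈ Finset.range j, (1 : ℝ) := by
          refine Finset.sum_le_sum fun n _ => ?_
          rw [add_comm 1 n, one_div_mul_eq_div, div_le_one (by positivity)]
          refine (ih n).trans ?_
          push_cast
          nlinarith [(Nat.cast_nonneg n : (0 : ℝ) ≤ n)]
      _ ≤ j + 1 := by simp

theorem nestedSum_succ_sub (k j : ℕ) :
    nestedSum (k + 1) (j + 2) - nestedSum (k + 1) (j + 1) =
      1 / (2 * ((j : ℝ) + 1)) ^ 2 * nestedSum k (j + 1) := by
  rw [nestedSum, nestedSum, Finset.sum_Ico_succ_top (by omega)]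
  push_cast
  ring

/-- The coefficient `4ʲ / (j² (2j choose j))` at `j = i + 1`. -/
noncomputable def arcsinWeight (i : ℕ) : ℝ :=
  4 ^ (i + 1) / (((i + 1 : ℕ) : ℝ) ^ 2 * (Nat.choose (2 * (i + 1)) (i + 1) : ℝ))

theorem arcsinWeight_nonneg (i : ℕ) : 0 ≤ arcsinWeight i := by
  unfold arcsinWeight
  positivity

theorem arcsinWeight_zero : arcsinWeight 0 = 2 := by
  norm_num [arcsinWeight]

theorem arcsinWeight_succ (i : ℕ) :
    (2 * (i : ℝ) + 3) * (2 * i + 4) * arcsinWeight (i + 1) =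
      (2 * ((i : ℝ) + 1)) ^ 2 * arcsinWeight i := by
  have h : (((i + 1 + 1 : ℕ) : ℝ)) * (Nat.choose (2 * (i + 1 + 1)) (i + 1 + 1) : ℝ) =
      2 * (2 * ((i + 1 : ℕ) : ℝ) + 1) * (Nat.choose (2 * (i + 1)) (i + 1) : ℝ) := by
    exact_mod_cast Nat.succ_mul_centralBinom_succ (i + 1)
  have hc : (0 : ℝ) < (Nat.choose (2 * (i + 1)) (i + 1) : ℝ) := by
    exact_mod_cast Nat.centralBinom_pos (i + 1)
  unfold arcsinWeight
  rw [sq (((i + 1 + 1 : ℕ) : ℝ)), mul_assoc (((i + 1 + 1 : ℕ) : ℝ)), h]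
  push_cast
  field_simp
  ring

theorem arcsinWeight_mul_le (i : ℕ) : arcsinWeight i * (i + 1) ≤ 2 := by
  have h : (4 : ℝ) ^ (i + 1) ≤ 2 * ((i + 1 : ℕ) : ℝ) * (Nat.choose (2 * (i + 1)) (i + 1) : ℝ) := by
    exact_mod_cast Nat.four_pow_le_two_mul_self_mul_centralBinom (i + 1) (by omega)
  have hc : (0 : ℝ) < (Nat.choose (2 * (i + 1)) (i + 1) : ℝ) := by
    exact_mod_cast Nat.centralBinom_pos (i + 1)
  unfold arcsinWeight
  rw [div_mul_eq_mul_div, div_le_iff₀ (by positivity)]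
  push_cast at h ⊢
  nlinarith [mul_le_mul_of_nonneg_right h (by positivity : (0 : ℝ) ≤ (i : ℝ) + 1)]

/-- Maclaurin coefficients of `arcsin x ^ (2 * m) / (2 * m)!`. -/
noncomputable def arcsinCoeff : ℕ → ℕ → ℝ
  | 0, n => if n = 0 then 1 else 0
  | _ + 1, 0 => 0
  | k + 1, n + 1 => if Even n then 0 else nestedH (k + 1) (n / 2 + 1) * arcsinWeight (n / 2)

theorem arcsinCoeff_even (k i : ℕ) :
    arcsinCoeff (k + 1) (2 * (i + 1)) = nestedH (k + 1) (i + 1) * arcsinWeight i := by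
  rw [show 2 * (i + 1) = 2 * i + 1 + 1 by ring, arcsinCoeff, if_neg (by simp),
    show (2 * i + 1) / 2 = i by omega]

theorem arcsinCoeff_odd (k i : ℕ) : arcsinCoeff k (2 * i + 1) = 0 := by
  cases k <;> simp [arcsinCoeff]

theorem abs_arcsinCoeff_le (k n : ℕ) : |arcsinCoeff k n| ≤ 2 := by
  match k, n with
  | 0, n => rw [arcsinCoeff]; split_ifs <;> norm_num
  | k + 1, 0 => simp [arcsinCoeff]
  | k + 1, n + 1 =>
    rw [arcsinCoeff]
    split_ifs
    · simp
    · have h1 := nestedSum_le k (n / 2)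
      have h2 := arcsinWeight_mul_le (n / 2)
      have h3 := arcsinWeight_nonneg (n / 2)
      have h4 := nestedSum_nonneg k (n / 2 + 1)
      rw [nestedH, abs_of_nonneg (by positivity)]
      nlinarith [mul_le_mul_of_nonneg_left h1 h3, mul_nonneg h3 h4]

/-- At even `n > 0` the weight ratio turns the left side into `n²` times a difference of consecutive
nested sums; that difference is the outermost term, whose `1/n²` cancels. -/
theorem arcsinCoeff_recurrence (k n : ℕ) :
    ((n : ℝ) + 1) * (((n : ℝ) + 2) * arcsinCoeff (k + 1) (n + 2))
      - (n : ℝ) ^ 2 * arcsinCoeff (k + 1) n = arcsinCoeff k n := by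
  obtain ⟨j, rfl | rfl⟩ := n.even_or_odd'
  · rw [show 2 * j + 2 = 2 * (j + 1) by ring, arcsinCoeff_even]
    cases j with
    | zero =>
      cases k with
      | zero => norm_num [arcsinCoeff, arcsinWeight_zero, nestedH, nestedSum]
      | succ k => simp [arcsinCoeff, nestedH, nestedSum]
    | succ i =>
      have hw := arcsinWeight_succ i
      rw [arcsinCoeff_even]
      cases k with
      | zero =>
        have : arcsinCoeff 0 (2 * (i + 1)) = 0 := by simp [arcsinCoeff]
        rw [this]
        simp only [nestedH, nestedSum]
        push_cast
        linear_combination (1 / 4) * hw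
      | succ k =>
        rw [arcsinCoeff_even]
        have hs := nestedSum_succ_sub k i
        have hi : (2 * ((i : ℝ) + 1)) ^ 2 ≠ 0 := by positivity
        have hs' : (2 * ((i : ℝ) + 1)) ^ 2 *
            (nestedSum (k + 1) (i + 2) - nestedSum (k + 1) (i + 1)) = nestedSum k (i + 1) := by
          rw [hs]; field_simp
        simp only [nestedH]
        push_cast
        rw [show i + 1 + 1 = i + 2 by ring]
        linear_combination (1 / 4) * nestedSum (k + 1) (i + 2) * hw +
          (1 / 4) * arcsinWeight i * hs'
  · rw [show 2 * j + 1 + 2 = 2 * (j + 1) + 1 by ring]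
    simp [arcsinCoeff_odd]

/-- The Maclaurin series of `arcsin x ^ (2 * m) / (2 * m)!`, at `x = sin θ`. -/
theorem tsum_arcsinCoeff_sin (m : ℕ) {θ : ℝ} (hθ : θ ∈ Set.Ioo (-(Real.pi / 2)) (Real.pi / 2)) :
    ∑' n, arcsinCoeff m n * Real.sin θ ^ n = θ ^ (2 * m) / (Nat.factorial (2 * m) : ℝ) := by
  induction m generalizing θ with
  | zero =>
    rw [tsum_eq_single 0 fun n hn => by simp [arcsinCoeff, hn]]
    simp [arcsinCoeff]
  | succ k ih =>
    have hsin : ∀ t ∈ Set.Ioo (-(Real.pi / 2)) (Real.pi / 2), |Real.sin t| < 1 := fun t ht => by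
      have hc := Real.cos_pos_of_mem_Ioo ht
      rw [← sq_lt_one_iff_abs_lt_one]
      nlinarith [Real.sin_sq_add_cos_sq t]
    set a := arcsinCoeff (k + 1) with ha
    have h0 : ∀ n, |a n| ≤ 2 * ((n + 0).choose 0 : ℝ) := by
      simpa using abs_arcsinCoeff_le (k + 1)
    set A := fun y : ℝ => ∑' n, a n * y ^ n with hA
    set A' := fun y : ℝ => ∑' n : ℕ, ((n : ℝ) + 1) * a (n + 1) * y ^ n with hA'
    set A'' := fun y : ℝ =>
      ∑' n : ℕ, ((n : ℝ) + 1) * ((((n + 1 : ℕ) : ℝ) + 1) * a (n + 1 + 1)) * y ^ n with hA''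
    have dA : ∀ y, |y| < 1 → HasDerivAt A (A' y) y := fun y hy => hasDerivAt_tsum_mul_pow h0 hy
    have dA' : ∀ y, |y| < 1 → HasDerivAt A' (A'' y) y := fun y hy =>
      hasDerivAt_tsum_mul_pow (a := fun n : ℕ => ((n : ℝ) + 1) * a (n + 1))
        (abs_succ_mul_le_choose h0) hy
    have ode : ∀ y, |y| < 1 → (1 - y ^ 2) * A'' y - y * A' y = ∑' n, arcsinCoeff k n * y ^ n :=
      fun y hy => tsum_ode_of_recurrence (abs_arcsinCoeff_le (k + 1)) (arcsinCoeff_recurrence k) hy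
    have hfact : (Nat.factorial (2 * (k + 1)) : ℝ) =
        (2 * k + 2) * ((2 * k + 1) * (Nat.factorial (2 * k) : ℝ)) := by
      rw [show 2 * (k + 1) = 2 * k + 1 + 1 by ring, Nat.factorial_succ, Nat.factorial_succ]
      push_cast
      ring
    have hne : (Nat.factorial (2 * k) : ℝ) ≠ 0 := by positivity
    -- The second derivative of `A (sin t)` is `cos² t * A'' - sin t * A'`, which `ode` and `ih`
    -- identify with `t^(2k)/(2k)!`.
    have key := eq_zero_of_second_deriv_eq_zero (r := Real.pi / 2)
      (f := fun t => A (Real.sin t) - t ^ (2 * (k + 1)) / (Nat.factorial (2 * (k + 1)) : ℝ))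
      (f' := fun t => A' (Real.sin t) * Real.cos t -
        t ^ (2 * k + 1) / ((2 * k + 1) * (Nat.factorial (2 * k) : ℝ)))
      (by positivity) (fun t ht => ?_) (fun t ht => ?_) ?_ ?_ hθ
    · exact sub_eq_zero.1 key
    · convert! ((dA _ (hsin t ht)).comp t (Real.hasDerivAt_sin t)).sub
        ((hasDerivAt_pow (2 * (k + 1)) t).div_const _) using 1
      rw [hfact, show 2 * (k + 1) - 1 = 2 * k + 1 by omega]
      push_cast
      field_simp
    · convert! (((dA' _ (hsin t ht)).comp t (Real.hasDerivAt_sin t)).mul (Real.hasDerivAt_cos t)).sub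
        ((hasDerivAt_pow (2 * k + 1) t).div_const _) using 1
      have h1 := ode _ (hsin t ht)
      rw [ih ht] at h1
      have h2 : (((2 * k + 1 : ℕ) : ℝ) * t ^ (2 * k + 1 - 1)) /
          ((2 * k + 1) * (Nat.factorial (2 * k) : ℝ)) =
          t ^ (2 * k) / (Nat.factorial (2 * k) : ℝ) := by
        rw [Nat.add_sub_cancel]
        push_cast
        field_simp
      rw [h2, ← h1, ← Real.cos_sq']
      simp only [Function.comp_apply]
      ring
    · have : A 0 = 0 := by
        simp only [hA]
        rw [tsum_eq_single 0 fun n hn => by simp [hn]]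
        simp [ha, arcsinCoeff]
      simp [this]
    · have : A' 0 = 0 := by
        simp only [hA']
        rw [tsum_eq_single 0 fun n hn => by simp [hn]]
        simp [ha, arcsinCoeff]
      simp [this]

/-! ### Evaluation at the two golden angles. -/

theorem hasSum_nestedH_mul_pow (k : ℕ) {θ x : ℝ}
    (hθ : θ ∈ Set.Ioo (-(Real.pi / 2)) (Real.pi / 2)) (hx : Real.sin θ = x / 2) :
    HasSum (fun i : ℕ => nestedH (k + 1) (i + 1) /
        (((i + 1 : ℕ) : ℝ) ^ 2 * (Nat.choose (2 * (i + 1)) (i + 1) : ℝ)) * x ^ (2 * (i + 1)))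
      (θ ^ (2 * (k + 1)) / (Nat.factorial (2 * (k + 1)) : ℝ)) := by
  have hsin : |Real.sin θ| < 1 := by
    have hc := Real.cos_pos_of_mem_Ioo hθ
    rw [← sq_lt_one_iff_abs_lt_one]
    nlinarith [Real.sin_sq_add_cos_sq θ]
  have hs := (summable_mul_pow_of_le_choose (a := arcsinCoeff (k + 1)) (C := 2) (k := 0)
    (by simpa using abs_arcsinCoeff_le (k + 1)) hsin).hasSum
  rw [tsum_arcsinCoeff_sin (k + 1) hθ] at hs
  have hinj : Function.Injective fun i : ℕ => 2 * (i + 1) := fun i j h => by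
    simp only at h; omega
  rw [← hinj.hasSum_iff fun n hn => ?_] at hs
  · convert! hs using 1
    ext i
    rw [Function.comp_apply, arcsinCoeff_even, hx, arcsinWeight, div_pow, pow_mul 2 2]
    norm_num
    field_simp
  · obtain ⟨j, rfl | rfl⟩ := n.even_or_odd'
    · cases j with
      | zero => simp [arcsinCoeff]
      | succ j => exact absurd ⟨j, rfl⟩ hn
    · simp [arcsinCoeff_odd]

/-- Each series over `j ≥ 1` is written as a series over `i : ℕ` with `j = i + 1`. -/
theorem theorem6 (s : ℤ) (m : ℕ) (hm : 1 ≤ m) :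
    HasSum
        (fun i : ℕ =>
          nestedH m (i + 1) /
              (((i + 1 : ℕ) : ℝ) ^ 2 * (Nat.choose (2 * (i + 1)) (i + 1) : ℝ)) *
            (Int.fib (2 * ((i + 1 : ℕ) : ℤ) + s) : ℝ))
        (1 / (Nat.factorial (2 * m) : ℝ) * (Real.pi / 10) ^ (2 * m) * (1 / Real.sqrt 5) *
          (((3 : ℝ) ^ (2 * m) + 1) * Real.goldenRatio ^ s - (intLucas s : ℝ))) ∧
      HasSum
        (fun i : ℕ =>
          nestedH m (i + 1) /
              (((i + 1 : ℕ) : ℝ) ^ 2 * (Nat.choose (2 * (i + 1)) (i + 1) : ℝ)) *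
            (intLucas (2 * ((i + 1 : ℕ) : ℤ) + s) : ℝ))
        (1 / (Nat.factorial (2 * m) : ℝ) * (Real.pi / 10) ^ (2 * m) *
          (((3 : ℝ) ^ (2 * m) - 1) * Real.goldenRatio ^ s + (intLucas s : ℝ))) := by
  obtain ⟨k, rfl⟩ : ∃ k, m = k + 1 := ⟨m - 1, by omega⟩
  have hpi := Real.pi_pos
  have h1 := (hasSum_nestedH_mul_pow k (θ := 3 * (Real.pi / 10))
    ⟨by linarith, by linarith⟩ sin_three_pi_div_ten).mul_right (Real.goldenRatio ^ s)
  have h2 := (hasSum_nestedH_mul_pow k (θ := -(Real.pi / 10))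
    ⟨by linarith, by linarith⟩ sin_neg_pi_div_ten).mul_right (Real.goldenConj ^ s)
  rw [mul_pow] at h1
  -- The angle is negative because the conjugate is; the even power removes the sign.
  rw [(even_two_mul (k + 1)).neg_pow] at h2
  have hz : ∀ (y : ℝ) (i : ℕ), y ≠ 0 →
      y ^ (2 * ((i + 1 : ℕ) : ℤ) + s) = y ^ (2 * (i + 1)) * y ^ s := fun y i hy => by
    rw [zpow_add₀ hy]
    norm_cast
  constructor
  · convert! (h1.sub h2).mul_right (1 / Real.sqrt 5) using 1
    · ext i
      rw [Real.coe_intFib_eq, hz _ _ Real.goldenRatio_ne_zero, hz _ _ Real.goldenConj_ne_zero]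
      ring
    · rw [intLucas_eq]
      ring
  · convert! h1.add h2 using 1
    · ext i
      rw [intLucas_eq, hz _ _ Real.goldenRatio_ne_zero, hz _ _ Real.goldenConj_ne_zero]
      ring
    · rw [intLucas_eq]
      ring
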